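/- Consider a Jackson network with $d\ge 1$ queues, arrival rates $\lambda_i\ge 0$, service rates $\mu_i>0$ and a substochastic routing matrix $P=(p_{ij})_{1\le i,j\le d}$ with $p_{ii}=0$; put $p_{i0}=1-\sum_{j=1}^d p_{ij}$. Let $\epsilon^i$ be the $i$-th unit vector, and for $v\in\mathbb Z^d$ let $q(v)=\lambda_i$ if $v=\epsilon^i$, $q(v)=\mu_ip_{i0}$ if $v=-\epsilon^i$, $q(v)=\mu_ip_{ij}$ if $v=\epsilon^j-\epsilon^i$ with $i\ne j$, and $q(v)=0$ otherwise. Let $(Z(t))_{t\ge 0}$ be the right-continuous Markov process on $\mathbb Z_+^d$ generated by $$\mathcal Lf(y)=\sum_{z\in\mathbb Z_+^d}q(z-y)\,(f(z)-f(y)),$$ with law $\mathbb P_x$ when started at $x$. Its essential spectral radius $r_e^*$ is the infimum of all $r>0$ for which there is a finite set $E\subset\mathbb Z_+^d$ such that $$\int_0^\infty r^{-t}\,\mathbb P_x\bigl(Z(t)=y,\ \tau_E>t\bigr)\,dt<+\infty\quad\text{for all }x,y\in\mathbb Z_+^d\setminus E,\qquad \tau_E=\inf\{t>0: Z(t)\in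 E\}.$$ Assume that (A) the matrix $(q(x-y))_{x,y\in\mathbb Z^d}$ is irreducible, and (B) $\nu_i<\mu_i$ for all $i$, where $(\nu_i)$ is the solution of the traffic equations $\nu_j=\lambda_j+\sum_{i=1}^d\nu_ip_{ij}$, $j=1,\dots,d$. Let $G=(\mathrm{Id}-P)^{-1}$. Let $Q_{ij}$ be the probability that the Markov chain on $\{0,\dots,d\}$ with transition probabilities $p_{ij}$ and absorbing state $0$, started at $i$, visits $j$ at some time $n\ge 0$. For $\gamma\in\mathbb R_+^d$ let $\overrightarrow{\gamma_i}\in\mathbb R^d$ be the vector with coordinates $\gamma_i^j=\log(1+Q_{ji}\gamma_i)$, and let $\Gamma$ be the set of all $\gamma\in\mathbb R_+^d$ such that for every $i$ and every nonzero $v\in\mathbb R_+^d$ with $v^i=0$, $$\overrightarrow{\gamma_i}\cdot v<\sup_{1\le j\le d}\overrightarrow{\gamma_j}\cdot v .$$ Then $$\log r_e^*\ \le\ -\sup_{\gamma\in\Gamma}\ \min_{1\le i\le d}\ \frac{\gamma_i}{G_{ii}}\left(\frac{\mu_i}{1+\gamma_i}-\nu_i\right).$$ -/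

import Mathlib

open MeasureTheory
open scoped NNReal ENNReal

/-- The parameters of a Jackson network with `d` queues: arrival rates `arr i`, service rates
`srv i` and the routing matrix `route`, which is substochastic with zero diagonal. -/
structure JacksonNetwork (d : ℕ) where
  arr : Fin d → ℝ
  srv : Fin d → ℝ
  route : Matrix (Fin d) (Fin d) ℝ
  arr_nonneg : ∀ i, 0 ≤ arr i
  srv_pos : ∀ i, 0 < srv i
  route_nonneg : ∀ i j, 0 ≤ route i j
  route_row_sum_le : ∀ i, ∑ j, route i j ≤ 1
  route_self : ∀ i, route i i = 0

namespace JacksonNetwork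

variable {d : ℕ}

/-- The probability `p_{i0}` that a customer leaves the network after service at queue `i`. -/
def exitProb (N : JacksonNetwork d) (i : Fin d) : ℝ := 1 - ∑ j, N.route i j

/-- The jump rates `q(v)`, `v ∈ ℤ^d`: `arr i` for `v = ε_i`, `srv i * p_{i0}` for `v = -ε_i`,
`srv i * p_{ij}` for `v = ε_j - ε_i` with `i ≠ j`, and `0` otherwise. (These vectors are pairwise
distinct, and the terms with `i = j` vanish as `p_{ii} = 0`.) -/
def jumpRate (N : JacksonNetwork d) (v : Fin d → ℤ) : ℝ :=
  (∑ i, if v = Pi.single i 1 then N.arr i else 0)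
    + (∑ i, if v = -Pi.single i 1 then N.srv i * N.exitProb i else 0)
    + ∑ i, ∑ j, if v = Pi.single j 1 - Pi.single i 1 then N.srv i * N.route i j else 0

/-- Assumption (A): the matrix `(q(x - y); x, y ∈ ℤ^d)` is irreducible. -/
def AssumptionA (N : JacksonNetwork d) : Prop :=
  Matrix.IsIrreducible (Matrix.of fun x y : Fin d → ℤ => N.jumpRate (x - y))

/-- `ν` solves the traffic equations `ν_j = λ_j + ∑_i ν_i p_{ij}`. -/
def IsTrafficSolution (N : JacksonNetwork d) (ν : Fin d → ℝ) : Prop :=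
  ∀ j, ν j = N.arr j + ∑ i, ν i * N.route i j

/-- The generator `(ℒ f)(x) = ∑_{z ∈ ℕ^d} q(z - x) (f z - f x)` on functions on `ℕ^d`
(for each `x` only finitely many terms of the sum are nonzero). -/
noncomputable def generator (N : JacksonNetwork d) (f : (Fin d → ℕ) → ℝ) (x : Fin d → ℕ) : ℝ :=
  ∑' z : Fin d → ℕ, N.jumpRate (fun i => (z i : ℤ) - (x i : ℤ)) * (f z - f x)

/-- The transition function `p_t(x, y) = (e^{tℒ} 1_{y})(x)` of the semigroup generated by `ℒ`.
The exponential series converges since `ℒ` is a bounded operator on bounded functions. -/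
noncomputable def transitionProb (N : JacksonNetwork d) (t : ℝ) (x y : Fin d → ℕ) : ℝ :=
  ∑' n : ℕ, t ^ n / (n.factorial : ℝ) * (N.generator^[n] (Pi.single y 1)) x

/-- `Z` under the laws `P x` (`x` the initial state) is a continuous time Markov process on `ℕ^d`
generated by `ℒ`: it has right-continuous paths and, for `0 = t_0 ≤ t_1 ≤ … ≤ t_n`, satisfies
`P_x(Z(t_0) = y_0, …, Z(t_n) = y_n) = 1_{x = y_0} ∏_{k < n} p_{t_{k+1} - t_k}(y_k, y_{k+1})`. -/
structure IsGeneratedMarkov (N : JacksonNetwork d) {Ω : Type*} [MeasurableSpace Ω]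
    (P : (Fin d → ℕ) → Measure Ω) (Z : ℝ≥0 → Ω → (Fin d → ℕ)) : Prop where
  isProbabilityMeasure : ∀ x, IsProbabilityMeasure (P x)
  measurable : ∀ t, Measurable (Z t)
  rightContinuous : ∀ ω t, ContinuousWithinAt (fun s => Z s ω) (Set.Ici t) t
  finiteDim : ∀ (x : Fin d → ℕ) (n : ℕ) (t : ℕ → ℝ≥0) (y : ℕ → Fin d → ℕ),
    t 0 = 0 → Monotone t →
      P x {ω | ∀ k ≤ n, Z (t k) ω = y k} =
        (if x = y 0 then 1 else 0) *
          ∏ k ∈ Finset.range n, ENNReal.ofReal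
            (N.transitionProb ((t (k + 1) : ℝ) - (t k : ℝ)) (y k) (y (k + 1)))

/-- The matrix `G = (Id - P)⁻¹`, `P` being the routing matrix. -/
noncomputable def green (N : JacksonNetwork d) : Matrix (Fin d) (Fin d) ℝ := (1 - N.route)⁻¹

/-- `P_i(τ_j = n)`, where `τ_j` is the first time `n ≥ 0` at which the auxiliary Markov chain
with transition probabilities `p_{ij}` and absorbing state `0` visits `j`: the sum of the
probabilities of all paths `i = w_0, w_1, …, w_n = j` with `w_k ≠ j` for `k < n`. (No path that
ends in `j ≠ 0` visits the absorbing state `0`.) -/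
def firstPassageProb (N : JacksonNetwork d) (n : ℕ) (i j : Fin d) : ℝ :=
  ∑ w : Fin (n + 1) → Fin d,
    if w 0 = i ∧ w (Fin.last n) = j ∧ ∀ k : Fin n, w k.castSucc ≠ j then
      ∏ k : Fin n, N.route (w k.castSucc) (w k.succ)
    else 0

/-- `Q_{ij} = P_i(τ_j < ∞)`. -/
noncomputable def hitProb (N : JacksonNetwork d) (i j : Fin d) : ℝ :=
  ∑' n : ℕ, N.firstPassageProb n i j

/-- The vector `γ⃗_i` with coordinates `γ_i^j = log (1 + Q_{ji} γ_i)`. -/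
noncomputable def gammaVec (N : JacksonNetwork d) (γ : Fin d → ℝ) (i : Fin d) : Fin d → ℝ :=
  fun j => Real.log (1 + N.hitProb j i * γ i)

/-- The set `Γ` of all `γ ∈ ℝ_+^d` such that for every `i` and every nonzero `v ∈ ℝ_+^d` with
`v^i = 0` one has `γ⃗_i ⬝ v < sup_j γ⃗_j ⬝ v`. -/
def gammaSet (N : JacksonNetwork d) : Set (Fin d → ℝ) :=
  {γ | (∀ i, 0 ≤ γ i) ∧ ∀ (i : Fin d) (v : Fin d → ℝ), (∀ j, 0 ≤ v j) → v ≠ 0 → v i = 0 →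
    N.gammaVec γ i ⬝ᵥ v < ⨆ j, N.gammaVec γ j ⬝ᵥ v}

end JacksonNetwork

/-- The hitting time `τ_E = inf {t > 0 : Z(t) ∈ E}`, with `inf ∅ = ∞`. -/
noncomputable def hitTime {Ω S : Type*} (Z : ℝ≥0 → Ω → S) (E : Set S) (ω : Ω) : ℝ≥0∞ :=
  ⨅ t ∈ {t : ℝ≥0 | 0 < t ∧ Z t ω ∈ E}, (t : ℝ≥0∞)

/-- The essential spectral radius `r_e^*`: the infimum of all `r > 0` for which there is a finite
set `E` with `∫_0^∞ r^{-t} P_x(Z(t) = y, τ_E > t) dt < ∞` for all `x, y ∉ E`. -/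
noncomputable def essSpectralRadius {Ω S : Type*} [MeasurableSpace Ω]
    (P : S → Measure Ω) (Z : ℝ≥0 → Ω → S) : ℝ≥0∞ :=
  sInf (ENNReal.ofReal '' {r : ℝ | 0 < r ∧ ∃ E : Set S, E.Finite ∧ ∀ x ∉ E, ∀ y ∉ E,
    ∫⁻ t in Set.Ioi (0 : ℝ), ENNReal.ofReal (r ^ (-t)) *
      P x {ω | Z t.toNNReal ω = y ∧ ENNReal.ofReal t < hitTime Z E ω} < ∞})

/-! The bound comes from a Lyapunov function. If `f > 0` satisfies `ℒ f ≤ -κ f` outside a finite set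
`E`, the process killed in `E` has `P_x(Z(t) = y, τ_E > t) ≤ f(x) / f(y) · e^{-κ' t}` for every `κ'
< κ`, and hence `log r_e^* ≤ -κ'` (`essSpectralRadius_le`).

The function is `f = ∑_i exp(γ⃗_i ⬝ x)`. A jump multiplies the `i`-th summand by ratios of the
weights `1 + Q_{ji} γ_i`. These weights are harmonic for the routing chain off `i`, so services at
other queues contribute nothing, and `generator_expFun` gives the summand the exact factor `-γ_i /
G_ii (μ_i / (1 + γ_i) - ν_i)` when `x_i > 0`. When `x_i = 0` the service term is missing and the
summand may grow, but there the condition defining `Γ` makes it exponentially small against `f`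
(`exists_gap`). Far from the origin the decay rate of `f` is thus the minimum over `i`, up to `ε`.

The killed estimate uses only finite-dimensional laws. The exponential series gives a contraction of
`f` over short times, uniform in the starting point outside `E` (`exists_short_time_contraction`);
iterating it along a time grid that avoids `E` gives the bound (`measure_killed_mul_le`). -/

namespace JacksonNetwork

open scoped Matrix

variable {d : ℕ} (N : JacksonNetwork d)

/-! ### Irreducibility, hitting probabilities of the routing chain and the matrix `G`. -/

lemma exitProb_nonneg (i : Fin d) : 0 ≤ N.exitProb i :=
  sub_nonneg.2 (N.route_row_sum_le i)

lemma jumpRate_nonneg (v : Fin d → ℤ) : 0 ≤ N.jumpRate v := by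
  unfold jumpRate
  refine add_nonneg (add_nonneg ?_ ?_) ?_
  · exact Finset.sum_nonneg fun i _ => by split_ifs <;> simp [N.arr_nonneg i]
  · exact Finset.sum_nonneg fun i _ => by
      split_ifs
      · exact mul_nonneg (N.srv_pos i).le (N.exitProb_nonneg i)
      · exact le_rfl
  · refine Finset.sum_nonneg fun i _ => Finset.sum_nonneg fun j _ => ?_
    split_ifs
    · exact mul_nonneg (N.srv_pos i).le (N.route_nonneg i j)
    · exact le_rfl

/-- A vector with nonzero jump rate is one of the three kinds of jumps. -/
lemma jumpRate_ne_zero {v : Fin d → ℤ} (hv : N.jumpRate v ≠ 0) :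
    (∃ i, v = Pi.single i 1) ∨ (∃ i, v = -Pi.single i 1 ∧ N.exitProb i ≠ 0) ∨
      ∃ i j, v = Pi.single j 1 - Pi.single i 1 ∧ N.route i j ≠ 0 := by
  contrapose! hv
  obtain ⟨h1, h2, h3⟩ := hv
  unfold jumpRate
  rw [Finset.sum_eq_zero, Finset.sum_eq_zero, Finset.sum_eq_zero]
  · simp
  · intro i _
    refine Finset.sum_eq_zero fun j _ => ?_
    split_ifs with h
    · simp [h3 i j h]
    · rfl
  · intro i _
    split_ifs with h
    · simp [h2 i h]
    · rfl
  · intro i _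
    simp [h1 i]

/-- Under irreducibility no nonempty set of queues is closed for the routing. -/
lemma AssumptionA.not_closed {N : JacksonNetwork d} (hA : N.AssumptionA) (M : Finset (Fin d))
    (hM : M.Nonempty) (hexit : ∀ i ∈ M, N.exitProb i = 0)
    (hroute : ∀ i ∈ M, ∀ j ∉ M, N.route i j = 0) : False := by
  obtain ⟨i, hi⟩ := hM
  have hjump : ∀ v : Fin d → ℤ, N.jumpRate v ≠ 0 → 0 ≤ ∑ k ∈ M, v k := by
    intro v hv
    rcases N.jumpRate_ne_zero hv with ⟨k, rfl⟩ | ⟨k, rfl, hk⟩ | ⟨k, l, rfl, hkl⟩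
    · simp only [Finset.sum_pi_single']
      split_ifs <;> simp
    · have : k ∉ M := fun h => hk (hexit k h)
      simp [Finset.sum_pi_single', this]
    · simp only [Pi.sub_apply, Finset.sum_sub_distrib, Finset.sum_pi_single']
      by_cases hk : k ∈ M
      · have hl : l ∈ M := by
          by_contra hl
          exact hkl (hroute k hk l hl)
        simp [hk, hl]
      · simp only [hk, if_false, sub_zero]
        split_ifs <;> simp
  -- An edge `x → y` carries the rate `q(x - y)`, so the number of customers in `M` can only
  -- decrease along paths. A path from `0` to `ε_i` with `i ∈ M` is then impossible.
  let := Matrix.toQuiver (Matrix.of fun x y : Fin d → ℤ => N.jumpRate (x - y))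
  have hpath : ∀ x y : Fin d → ℤ, Quiver.Path x y → ∑ k ∈ M, y k ≤ ∑ k ∈ M, x k := by
    intro x y p
    induction p with
    | nil => exact le_rfl
    | cons p e ih =>
      refine le_trans ?_ ih
      have := hjump _ (ne_of_gt e.down)
      simpa [Finset.sum_sub_distrib] using this
  obtain ⟨p, -⟩ := hA.connected 0 (Pi.single i 1)
  have := hpath _ _ p
  simp [Finset.sum_pi_single', hi] at this

/-- Maximum principle: if `u = P u`, the set where `|u|` is maximal has full row sums and cannot be
left by the routing, which `not_closed` excludes. -/
lemma AssumptionA.det_ne_zero {N : JacksonNetwork d} (hA : N.AssumptionA) :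
    (1 - N.route).det ≠ 0 := by
  intro h0
  obtain ⟨u, hu0, hu⟩ := Matrix.exists_mulVec_eq_zero_iff.2 h0
  have hfix : ∀ i, u i = ∑ j, N.route i j * u j := by
    intro i
    have := congrFun hu i
    rw [Matrix.sub_mulVec, Matrix.one_mulVec] at this
    simpa [sub_eq_zero, Matrix.mulVec, dotProduct] using this
  obtain ⟨k, hk⟩ := Function.ne_iff.1 hu0
  obtain ⟨m, -, hm⟩ := Finset.exists_max_image Finset.univ (fun i => |u i|) ⟨k, Finset.mem_univ k⟩
  have hpos : 0 < |u m| := lt_of_lt_of_le (abs_pos.2 hk) (hm k (Finset.mem_univ k))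
  have key : ∀ i, |u i| = |u m| → (∑ j, N.route i j = 1 ∧ ∀ j, N.route i j * (|u m| - |u j|) = 0) := by
    intro i hi
    have h1 : |u m| ≤ ∑ j, N.route i j * |u j| := by
      rw [← hi, hfix i]
      refine (Finset.abs_sum_le_sum_abs _ _).trans_eq ?_
      simp [abs_mul, abs_of_nonneg (N.route_nonneg i _)]
    have hnn : ∀ j ∈ Finset.univ, 0 ≤ N.route i j * (|u m| - |u j|) := fun j hj =>
      mul_nonneg (N.route_nonneg i j) (sub_nonneg.2 (hm j hj))
    have h2 : ∑ j, N.route i j * (|u m| - |u j|)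
        = (∑ j, N.route i j) * |u m| - ∑ j, N.route i j * |u j| := by
      simp [mul_sub, Finset.sum_mul]
    have h3 := Finset.sum_nonneg hnn
    have h4 : (∑ j, N.route i j) * |u m| ≤ 1 * |u m| :=
      mul_le_mul_of_nonneg_right (N.route_row_sum_le i) hpos.le
    refine ⟨le_antisymm (N.route_row_sum_le i) ?_, fun j => ?_⟩
    · exact le_of_mul_le_mul_right (by linarith) hpos
    · exact (Finset.sum_eq_zero_iff_of_nonneg hnn).1 (by linarith) j (Finset.mem_univ j)
  refine hA.not_closed (Finset.univ.filter fun i => |u i| = |u m|) ⟨m, by simp⟩ ?_ ?_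
  · intro i hi
    simp [exitProb, (key i (by simpa using hi)).1]
  · intro i hi j hj
    have := (key i (by simpa using hi)).2 j
    rcases mul_eq_zero.1 this with h | h
    · exact h
    · exact absurd (by simpa using (sub_eq_zero.1 h).symm) hj

lemma firstPassageProb_nonneg (n : ℕ) (i j : Fin d) : 0 ≤ N.firstPassageProb n i j := by
  refine Finset.sum_nonneg fun w _ => ?_
  split_ifs
  · exact Finset.prod_nonneg fun k _ => N.route_nonneg _ _
  · exact le_rfl

lemma firstPassageProb_zero (i j : Fin d) :
    N.firstPassageProb 0 i j = if i = j then 1 else 0 := by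
  unfold firstPassageProb
  rw [← (Equiv.funUnique (Fin 1) (Fin d)).symm.sum_comp]
  simp [Equiv.funUnique, ite_and, eq_comm]

lemma firstPassageProb_succ (n : ℕ) (i j : Fin d) :
    N.firstPassageProb (n + 1) i j =
      if i = j then 0 else ∑ k, N.route i k * N.firstPassageProb n k j := by
  unfold firstPassageProb
  rw [← (Fin.consEquiv fun _ : Fin (n + 2) => Fin d).sum_comp, Fintype.sum_prod_type]
  simp only [Fin.consEquiv, Equiv.coe_fn_mk, Fin.cons_zero]
  rw [Finset.sum_eq_single i]
  · split_ifs with hij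
    · refine Finset.sum_eq_zero fun w _ => if_neg ?_
      rintro ⟨-, -, h⟩
      exact h 0 (by simpa using hij)
    · simp only [Finset.mul_sum]
      rw [Finset.sum_comm]
      refine Finset.sum_congr rfl fun w _ => ?_
      rw [Finset.sum_eq_single (w 0)]
      · rw [Fin.prod_univ_succ, mul_ite, mul_zero]
        congr 1
        simp only [true_and, Fin.forall_fin_succ (n := n), eq_iff_iff]
        simp [← Fin.succ_last, hij]
      · intro b _ hb
        rw [if_neg fun h => hb h.1.symm, mul_zero]
      · simp
  · intro b _ hb
    exact Finset.sum_eq_zero fun w _ => if_neg fun h => hb h.1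
  · simp

/-- Induction on the first step replaces the disjointness of the events `τ_j = m`. -/
lemma sum_range_firstPassageProb_le_one (n : ℕ) (i j : Fin d) :
    ∑ m ∈ Finset.range n, N.firstPassageProb m i j ≤ 1 := by
  induction n generalizing i with
  | zero => simp
  | succ n ih =>
    rw [Finset.sum_range_succ', firstPassageProb_zero]
    simp only [firstPassageProb_succ]
    split_ifs with h
    · simp
    · rw [Finset.sum_comm, add_zero]
      calc ∑ k, ∑ m ∈ Finset.range n, N.route i k * N.firstPassageProb m k j
          ≤ ∑ k, N.route i k := by
            refine Finset.sum_le_sum fun k _ => ?_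
            rw [← Finset.mul_sum]
            exact mul_le_of_le_one_right (N.route_nonneg i k) (ih k)
        _ ≤ 1 := N.route_row_sum_le i

lemma summable_firstPassageProb (i j : Fin d) : Summable fun n => N.firstPassageProb n i j :=
  summable_of_sum_range_le (fun n => N.firstPassageProb_nonneg n i j)
    fun n => N.sum_range_firstPassageProb_le_one n i j

lemma hitProb_nonneg (i j : Fin d) : 0 ≤ N.hitProb i j :=
  tsum_nonneg fun n => N.firstPassageProb_nonneg n i j

lemma hitProb_eq (i j : Fin d) :
    N.hitProb i j = if i = j then 1 else ∑ k, N.route i k * N.hitProb k j := by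
  unfold hitProb
  rw [(N.summable_firstPassageProb i j).tsum_eq_zero_add, firstPassageProb_zero]
  simp only [firstPassageProb_succ]
  split_ifs with h
  · simp
  · rw [zero_add, Summable.tsum_finsetSum]
    · simp [tsum_mul_left]
    · exact fun k _ => (N.summable_firstPassageProb k j).mul_left _

lemma hitProb_self (j : Fin d) : N.hitProb j j = 1 := by
  rw [hitProb_eq, if_pos rfl]

/-- The columns of the matrix of hitting probabilities are proportional to those of `G`. -/
lemma hitProb_eq_green {N : JacksonNetwork d} (hA : N.AssumptionA) (i j : Fin d) :
    N.hitProb i j = (1 - ∑ k, N.route j k * N.hitProb k j) * N.green i j := by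
  set c := 1 - ∑ k, N.route j k * N.hitProb k j with hc
  -- The `j`-th column of `Q` is harmonic off `j`, so `Id - P` maps it to a multiple of the unit
  -- vector at `j`.
  have h1 : (1 - N.route) *ᵥ (fun i => N.hitProb i j) = Pi.single j c := by
    ext i
    rw [Matrix.sub_mulVec, Matrix.one_mulVec]
    simp only [Pi.sub_apply, Matrix.mulVec, dotProduct]
    rcases eq_or_ne i j with rfl | h
    · simp [hitProb_self, hc]
    · rw [Pi.single_eq_of_ne h, N.hitProb_eq i j, if_neg h, sub_self]
  have h2 := congrArg (fun u => N.green *ᵥ u) h1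
  simp only [Matrix.mulVec_mulVec, green,
    Matrix.nonsing_inv_mul _ (isUnit_iff_ne_zero.2 hA.det_ne_zero), Matrix.one_mulVec] at h2
  have := congrFun h2 i
  rw [this]
  simp [green, Matrix.mulVec_single, mul_comm]

/-- The diagonal case `Q_jj = 1`: the probability of never returning to `j` is `1 / G_jj`. -/
lemma green_self {N : JacksonNetwork d} (hA : N.AssumptionA) (j : Fin d) :
    1 - ∑ k, N.route j k * N.hitProb k j = (N.green j j)⁻¹ := by
  have := hitProb_eq_green hA j j
  rw [hitProb_self] at this
  exact eq_inv_of_mul_eq_one_left this.symm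

/-- The traffic equations say `ν = λ G`, and `Q_{ij} = G_{ij} / G_{jj}`. -/
lemma sum_arr_mul_hitProb {N : JacksonNetwork d} (hA : N.AssumptionA) {ν : Fin d → ℝ}
    (hν : N.IsTrafficSolution ν) (j : Fin d) :
    ∑ i, N.arr i * N.hitProb i j = (N.green j j)⁻¹ * ν j := by
  have h1 : ν ᵥ* (1 - N.route) = N.arr := by
    ext i
    rw [Matrix.vecMul_sub, Matrix.vecMul_one, Pi.sub_apply]
    simp only [Matrix.vecMul, dotProduct]
    linarith [hν i]
  have h2 : N.arr ᵥ* N.green = ν := by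
    rw [← h1, green, Matrix.vecMul_vecMul,
      Matrix.mul_nonsing_inv _ (isUnit_iff_ne_zero.2 hA.det_ne_zero), Matrix.vecMul_one]
  rw [← congrFun h2 j]
  simp only [Matrix.vecMul, dotProduct, Finset.mul_sum]
  refine Finset.sum_congr rfl fun i _ => ?_
  rw [hitProb_eq_green hA i j, green_self hA]
  ring

end JacksonNetwork

/-! ### The generator and the short-time expansion of the transition function. -/

namespace JacksonNetwork

variable {d : ℕ} (N : JacksonNetwork d)

/-- The jump rate from the state `x` to the state `z`. -/
def rate (x z : Fin d → ℕ) : ℝ := N.jumpRate fun i => (z i : ℤ) - (x i : ℤ)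

lemma rate_nonneg (x z : Fin d → ℕ) : 0 ≤ N.rate x z := N.jumpRate_nonneg _

lemma finite_support_jumpRate : (Function.support N.jumpRate).Finite := by
  refine ((Set.finite_range fun i : Fin d => (Pi.single i 1 : Fin d → ℤ)).union
    ((Set.finite_range fun i : Fin d => (-Pi.single i 1 : Fin d → ℤ)).union
      (Set.finite_range fun p : Fin d × Fin d =>
        (Pi.single p.2 1 - Pi.single p.1 1 : Fin d → ℤ)))).subset ?_
  intro v hv
  rcases N.jumpRate_ne_zero hv with ⟨i, rfl⟩ | ⟨i, rfl, -⟩ | ⟨i, j, rfl, -⟩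
  · exact Or.inl ⟨i, rfl⟩
  · exact Or.inr (Or.inl ⟨i, rfl⟩)
  · exact Or.inr (Or.inr ⟨(i, j), rfl⟩)

lemma injective_displacement (x : Fin d → ℕ) :
    Function.Injective fun (z : Fin d → ℕ) (i : Fin d) => (z i : ℤ) - (x i : ℤ) := by
  intro z w h
  ext i
  have := congrFun h i
  simp only at this
  omega

lemma finite_support_rate (x : Fin d → ℕ) : (Function.support (N.rate x)).Finite :=
  N.finite_support_jumpRate.preimage (injective_displacement x).injOn

lemma abs_displacement_le_one {x z : Fin d → ℕ} (h : N.rate x z ≠ 0) (i : Fin d) :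
    |(z i : ℤ) - (x i : ℤ)| ≤ 1 := by
  have key : ∀ v : Fin d → ℤ, N.jumpRate v ≠ 0 → |v i| ≤ 1 := by
    intro v hv
    rcases N.jumpRate_ne_zero hv with ⟨k, rfl⟩ | ⟨k, rfl, -⟩ | ⟨k, j, rfl, -⟩
    · rw [Pi.single_apply]; split_ifs <;> simp
    · rw [Pi.neg_apply, Pi.single_apply]; split_ifs <;> simp
    · rw [Pi.sub_apply, Pi.single_apply, Pi.single_apply]; split_ifs <;> simp
  exact key _ h

lemma hasSum_rate_mul (x : Fin d → ℕ) (g : (Fin d → ℕ) → ℝ) :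
    HasSum (fun z => N.rate x z * g z) (∑' z, N.rate x z * g z) :=
  (summable_of_hasFiniteSupport ((N.finite_support_rate x).subset fun z hz => by
    simp only [Function.mem_support, ne_eq, mul_eq_zero, not_or] at hz ⊢
    exact hz.1)).hasSum

lemma hasSum_rate (x : Fin d → ℕ) : HasSum (N.rate x) (∑' z, N.rate x z) :=
  (summable_of_hasFiniteSupport (N.finite_support_rate x)).hasSum

lemma generator_eq_tsum (f : (Fin d → ℕ) → ℝ) (x : Fin d → ℕ) :
    N.generator f x = ∑' z, N.rate x z * (f z - f x) := rfl

lemma generator_eq_sub (f : (Fin d → ℕ) → ℝ) (x : Fin d → ℕ) :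
    N.generator f x = (∑' z, N.rate x z * f z) - (∑' z, N.rate x z) * f x := by
  rw [generator_eq_tsum]
  simp only [mul_sub]
  exact ((N.hasSum_rate_mul x f).sub ((N.hasSum_rate x).mul_right (f x))).tsum_eq

lemma generator_single (x z : Fin d → ℕ) :
    N.generator (Pi.single z 1) x =
      N.rate x z - (∑' w, N.rate x w) * (Pi.single z 1 : (Fin d → ℕ) → ℝ) x := by
  rw [generator_eq_sub, tsum_eq_single z]
  · simp
  · intro w hw
    simp [Pi.single_eq_of_ne hw]

/-- The total rate of all jumps. -/
noncomputable def totalRate : ℝ≥0∞ := ∑' v, ENNReal.ofReal (N.jumpRate v)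

lemma totalRate_ne_top : N.totalRate ≠ ⊤ := by
  unfold totalRate
  rw [← ENNReal.ofReal_tsum_of_nonneg N.jumpRate_nonneg
    (summable_of_hasFiniteSupport N.finite_support_jumpRate)]
  exact ENNReal.ofReal_ne_top

lemma tsum_ofReal_rate_le (x : Fin d → ℕ) :
    ∑' z, ENNReal.ofReal (N.rate x z) ≤ N.totalRate :=
  ENNReal.tsum_comp_le_tsum_of_injective (injective_displacement x)
    fun v => ENNReal.ofReal (N.jumpRate v)

lemma tsum_rate_le (x : Fin d → ℕ) : ∑' z, N.rate x z ≤ N.totalRate.toReal := by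
  rw [← ENNReal.ofReal_le_iff_le_toReal N.totalRate_ne_top,
    ENNReal.ofReal_tsum_of_nonneg (N.rate_nonneg x) (N.hasSum_rate x).summable]
  exact N.tsum_ofReal_rate_le x

/-- A positive operator that dominates the generator. -/
noncomputable def domOp (g : (Fin d → ℕ) → ℝ≥0∞) (x : Fin d → ℕ) : ℝ≥0∞ :=
  ∑' z, ENNReal.ofReal (N.rate x z) * (g z + g x)

lemma domOp_mono : Monotone N.domOp := fun _ _ h _ =>
  ENNReal.tsum_le_tsum fun _ => mul_le_mul_right (add_le_add (h _) (h _)) _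

lemma domOp_tsum {ι : Type*} (c : ι → ℝ≥0∞) (g : ι → (Fin d → ℕ) → ℝ≥0∞) :
    N.domOp (fun y => ∑' i, c i * g i y) = fun x => ∑' i, c i * N.domOp (g i) x := by
  ext x
  simp only [domOp, ← ENNReal.tsum_add, ← ENNReal.tsum_mul_left]
  rw [ENNReal.tsum_comm]
  refine tsum_congr fun i => tsum_congr fun z => ?_
  ring

lemma domOp_const_mul (c : ℝ≥0∞) (g : (Fin d → ℕ) → ℝ≥0∞) :
    N.domOp (fun y => c * g y) = fun x => c * N.domOp g x := by
  simpa using N.domOp_tsum (fun _ : Unit => c) fun _ => g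

lemma domOp_iterate_tsum {ι : Type*} (n : ℕ) (c : ι → ℝ≥0∞) (g : ι → (Fin d → ℕ) → ℝ≥0∞) :
    N.domOp^[n] (fun y => ∑' i, c i * g i y) = fun x => ∑' i, c i * N.domOp^[n] (g i) x := by
  induction n with
  | zero => rfl
  | succ n ih => simp only [Function.iterate_succ_apply', ih, domOp_tsum]

lemma domOp_iterate_le {C : ℝ≥0∞} {F : (Fin d → ℕ) → ℝ≥0∞} (hF : ∀ x, N.domOp F x ≤ C * F x)
    (n : ℕ) (x : Fin d → ℕ) : N.domOp^[n] F x ≤ C ^ n * F x := by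
  induction n generalizing x with
  | zero => simp
  | succ n ih =>
    rw [Function.iterate_succ_apply']
    calc N.domOp (N.domOp^[n] F) x ≤ N.domOp (fun y => C ^ n * F y) x := N.domOp_mono ih x
      _ = C ^ n * N.domOp F x := by rw [domOp_const_mul]
      _ ≤ C ^ n * (C * F x) := mul_le_mul_right (hF x) _
      _ = C ^ (n + 1) * F x := by ring

lemma enorm_generator_le (g : (Fin d → ℕ) → ℝ) (x : Fin d → ℕ) :
    ‖N.generator g x‖ₑ ≤ N.domOp (fun y => ‖g y‖ₑ) x := by
  rw [generator_eq_tsum]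
  refine enorm_tsum_le_tsum_enorm.trans (ENNReal.tsum_le_tsum fun z => ?_)
  rw [enorm_mul, Real.enorm_of_nonneg (N.rate_nonneg x z)]
  exact mul_le_mul_right enorm_sub_le _

lemma enorm_generator_iterate_le (n : ℕ) (g : (Fin d → ℕ) → ℝ) (x : Fin d → ℕ) :
    ‖N.generator^[n] g x‖ₑ ≤ N.domOp^[n] (fun y => ‖g y‖ₑ) x := by
  induction n generalizing x with
  | zero => rfl
  | succ n ih =>
    rw [Function.iterate_succ_apply', Function.iterate_succ_apply']
    exact (N.enorm_generator_le _ x).trans (N.domOp_mono ih x)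

/-- Since `F = ∑_z F(z) 1_z` and `domOp` commutes with nonnegative sums, all targets `z` are handled
at once. This controls the exponential series against an unbounded weight `F`. -/
lemma tsum_mul_enorm_generator_iterate_le {C : ℝ≥0∞} {F : (Fin d → ℕ) → ℝ≥0∞}
    (hF : ∀ x, N.domOp F x ≤ C * F x) (n : ℕ) (x : Fin d → ℕ) :
    ∑' z, F z * ‖N.generator^[n] (Pi.single z 1) x‖ₑ ≤ C ^ n * F x := by
  have h1 : (fun y => ∑' z, F z * ‖(Pi.single z 1 : (Fin d → ℕ) → ℝ) y‖ₑ) = F := by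
    ext y
    rw [tsum_eq_single y]
    · simp
    · intro z hz
      simp [Pi.single_eq_of_ne hz.symm]
  calc ∑' z, F z * ‖N.generator^[n] (Pi.single z 1) x‖ₑ
      ≤ ∑' z, F z * N.domOp^[n] (fun y => ‖(Pi.single z 1 : (Fin d → ℕ) → ℝ) y‖ₑ) x :=
        ENNReal.tsum_le_tsum fun z => mul_le_mul_right (N.enorm_generator_iterate_le n _ x) _
    _ = N.domOp^[n] F x := by
        rw [← congrFun (N.domOp_iterate_tsum n F
          fun z y => ‖(Pi.single z 1 : (Fin d → ℕ) → ℝ) y‖ₑ) x, h1]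
    _ ≤ C ^ n * F x := N.domOp_iterate_le hF n x

lemma domOp_ofReal_le {f : (Fin d → ℕ) → ℝ} {B : ℝ} (hB : 0 ≤ B)
    (hf : ∀ x z, N.rate x z ≠ 0 → f z ≤ B * f x) (x : Fin d → ℕ) :
    N.domOp (fun y => ENNReal.ofReal (f y)) x
      ≤ N.totalRate * (ENNReal.ofReal B + 1) * ENNReal.ofReal (f x) := by
  calc N.domOp (fun y => ENNReal.ofReal (f y)) x
      ≤ ∑' z, ENNReal.ofReal (N.rate x z) * ((ENNReal.ofReal B + 1) * ENNReal.ofReal (f x)) := by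
        refine ENNReal.tsum_le_tsum fun z => ?_
        rcases eq_or_ne (N.rate x z) 0 with h | h
        · simp [h]
        · refine mul_le_mul_right ?_ _
          rw [add_mul, one_mul, ← ENNReal.ofReal_mul hB]
          exact add_le_add_left (ENNReal.ofReal_le_ofReal (hf x z h)) _
    _ ≤ _ := by
        rw [ENNReal.tsum_mul_right, mul_assoc]
        exact mul_le_mul_left (N.tsum_ofReal_rate_le x) _

/-- The transition function is at most its first order expansion plus a remainder. -/
lemma ofReal_transitionProb_le {h : ℝ} (hh : 0 ≤ h) (x z : Fin d → ℕ) :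
    ENNReal.ofReal (N.transitionProb h x z) ≤
      ENNReal.ofReal ((Pi.single z 1 : (Fin d → ℕ) → ℝ) x + h * N.generator (Pi.single z 1) x)
        + ∑' n : ℕ, ENNReal.ofReal (h ^ (n + 2) / (n + 2).factorial)
            * ‖N.generator^[n + 2] (Pi.single z 1) x‖ₑ := by
  unfold transitionProb
  by_cases hs : Summable fun n : ℕ =>
    h ^ n / (n.factorial : ℝ) * (N.generator^[n] (Pi.single z 1)) x
  · rw [← hs.sum_add_tsum_nat_add 2]
    refine ENNReal.ofReal_add_le.trans (add_le_add ?_ ?_)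
    · simp [Finset.sum_range_succ]
    · refine (Real.ofReal_le_enorm _).trans (enorm_tsum_le_tsum_enorm.trans_eq ?_)
      refine tsum_congr fun n => ?_
      rw [enorm_mul, Real.enorm_of_nonneg (by positivity)]
  -- A divergent series has sum `0` by convention, so the bound is trivial.
  · rw [tsum_eq_zero_of_not_summable hs]
    simp

lemma hasSum_first_order (f : (Fin d → ℕ) → ℝ) (h : ℝ) (x : Fin d → ℕ) :
    HasSum (fun z => f z * ((Pi.single z 1 : (Fin d → ℕ) → ℝ) x
      + h * N.generator (Pi.single z 1) x)) (f x + h * N.generator f x) := by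
  have h1 : HasSum (fun z => (1 - h * ∑' w, N.rate x w)
      * (f z * (Pi.single z 1 : (Fin d → ℕ) → ℝ) x)) ((1 - h * ∑' w, N.rate x w) * f x) := by
    refine HasSum.mul_left _ ?_
    have h2 := hasSum_single (f := fun z => f z * (Pi.single z 1 : (Fin d → ℕ) → ℝ) x) x
      fun z hz => by simp [Pi.single_eq_of_ne hz.symm]
    simpa using h2
  convert h1.add ((N.hasSum_rate_mul x f).mul_left h) using 1
  · ext z
    rw [generator_single]
    ring
  · rw [generator_eq_sub]
    ring

/-- When `h` times the total rate is at most `1`, the first-order kernel `Id + h ℒ` has nonnegative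
entries, so truncation by `ENNReal.ofReal` loses nothing. -/
lemma tsum_mul_ofReal_first_order {f : (Fin d → ℕ) → ℝ} (hf : ∀ x, 0 < f x) {h : ℝ} (hh : 0 ≤ h)
    (hΛ : h * N.totalRate.toReal ≤ 1) (x : Fin d → ℕ) :
    0 ≤ f x + h * N.generator f x ∧
    ∑' z, ENNReal.ofReal (f z) * ENNReal.ofReal ((Pi.single z 1 : (Fin d → ℕ) → ℝ) x
      + h * N.generator (Pi.single z 1) x) = ENNReal.ofReal (f x + h * N.generator f x) := by
  have hnn : ∀ z, 0 ≤ f z * ((Pi.single z 1 : (Fin d → ℕ) → ℝ) x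
      + h * N.generator (Pi.single z 1) x) := by
    intro z
    refine mul_nonneg (hf z).le ?_
    rw [generator_single]
    have h1 : h * ∑' w, N.rate x w ≤ 1 :=
      (mul_le_mul_of_nonneg_left (N.tsum_rate_le x) hh).trans hΛ
    have h2 : 0 ≤ (Pi.single z 1 : (Fin d → ℕ) → ℝ) x := by
      rw [Pi.single_apply]; split_ifs <;> simp
    nlinarith [mul_nonneg hh (N.rate_nonneg x z), mul_nonneg h2 (sub_nonneg.2 h1)]
  have hsum := N.hasSum_first_order f h x
  refine ⟨hsum.nonneg hnn, ?_⟩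
  rw [← hsum.tsum_eq, ENNReal.ofReal_tsum_of_nonneg hnn hsum.summable]
  exact tsum_congr fun z => (ENNReal.ofReal_mul (hf z).le).symm

lemma exists_tsum_mul_transitionProb_le {f : (Fin d → ℕ) → ℝ} (hf : ∀ x, 0 < f x) {B : ℝ}
    (hB : 0 ≤ B) (hfB : ∀ x z, N.rate x z ≠ 0 → f z ≤ B * f x) :
    ∃ D : ℝ, 0 ≤ D ∧ ∀ h, 0 ≤ h → h ≤ 1 → h * N.totalRate.toReal ≤ 1 → ∀ x,
      ∑' z, ENNReal.ofReal (f z) * ENNReal.ofReal (N.transitionProb h x z)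
        ≤ ENNReal.ofReal (f x + h * N.generator f x + D * h ^ 2 * f x) := by
  set C := N.totalRate * (ENNReal.ofReal B + 1) with hC
  have hCtop : C ≠ ⊤ := ENNReal.mul_ne_top N.totalRate_ne_top (by simp)
  have hF := N.domOp_ofReal_le hB hfB
  set c := C.toReal with hc
  have hCc : C = ENNReal.ofReal c := (ENNReal.ofReal_toReal hCtop).symm
  have hc0 : 0 ≤ c := ENNReal.toReal_nonneg
  have hexp := Real.summable_pow_div_factorial c
  -- The remainder terms have order `n + 2`; `h ^ (n + 2) ≤ h ^ 2` and `n! ≤ (n + 2)!` leave `c² e^c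
  -- h²`.
  refine ⟨c ^ 2 * ∑' n : ℕ, c ^ n / n.factorial, by positivity, ?_⟩
  intro h hh h1 hΛ x
  obtain ⟨hnn, hfirst⟩ := N.tsum_mul_ofReal_first_order hf hh hΛ x
  have hrem : ∑' z, ENNReal.ofReal (f z) *
      ∑' n : ℕ, ENNReal.ofReal (h ^ (n + 2) / (n + 2).factorial)
        * ‖N.generator^[n + 2] (Pi.single z 1) x‖ₑ
      ≤ ENNReal.ofReal (c ^ 2 * (∑' n : ℕ, c ^ n / n.factorial) * h ^ 2 * f x) := by
    simp only [← ENNReal.tsum_mul_left]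
    rw [ENNReal.tsum_comm]
    calc ∑' (n : ℕ) (z : Fin d → ℕ), ENNReal.ofReal (f z) *
          (ENNReal.ofReal (h ^ (n + 2) / (n + 2).factorial)
            * ‖N.generator^[n + 2] (Pi.single z 1) x‖ₑ)
        ≤ ∑' n : ℕ, ENNReal.ofReal (c ^ 2 * h ^ 2 * f x * (c ^ n / n.factorial)) := by
          refine ENNReal.tsum_le_tsum fun n => ?_
          simp only [mul_left_comm (ENNReal.ofReal (f _)), ENNReal.tsum_mul_left]
          refine (mul_le_mul_right (N.tsum_mul_enorm_generator_iterate_le hF (n + 2) x) _).trans ?_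
          rw [← hC, hCc, ← ENNReal.ofReal_pow hc0, ← ENNReal.ofReal_mul (by positivity),
            ← ENNReal.ofReal_mul (by positivity)]
          refine ENNReal.ofReal_le_ofReal ?_
          have hfac : ((n.factorial : ℕ) : ℝ) ≤ ((n + 2).factorial : ℕ) :=
            Nat.cast_le.2 (Nat.factorial_le (by omega))
          have hpow : h ^ (n + 2) ≤ h ^ 2 := pow_le_pow_of_le_one hh h1 (by omega)
          have hdiv : h ^ (n + 2) / ((n + 2).factorial : ℝ) ≤ h ^ 2 / (n.factorial : ℝ) :=
            div_le_div₀ (by positivity) hpow (by positivity) hfac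
          calc h ^ (n + 2) / ((n + 2).factorial : ℝ) * (c ^ (n + 2) * f x)
              ≤ h ^ 2 / (n.factorial : ℝ) * (c ^ (n + 2) * f x) :=
                mul_le_mul_of_nonneg_right hdiv (mul_nonneg (by positivity) (hf x).le)
            _ = c ^ 2 * h ^ 2 * f x * (c ^ n / n.factorial) := by ring
      _ = _ := by
          rw [← ENNReal.ofReal_tsum_of_nonneg, tsum_mul_left]
          · congr 1
            ring
          · exact fun n => mul_nonneg (mul_nonneg (by positivity) (hf x).le) (by positivity)
          · exact hexp.mul_left _
  rw [ENNReal.ofReal_add hnn (mul_nonneg (mul_nonneg (by positivity) (by positivity)) (hf x).le),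
    ← hfirst]
  refine le_trans ?_ (add_le_add_right hrem _)
  rw [← ENNReal.tsum_add]
  refine ENNReal.tsum_le_tsum fun z => ?_
  rw [← mul_add]
  exact mul_le_mul_right (N.ofReal_transitionProb_le hh x z) _

/-- A function with `ℒ f ≤ -κ f` outside `E` is contracted by the transition function over short
times, for starting points outside `E`. -/
lemma exists_short_time_contraction {f : (Fin d → ℕ) → ℝ} (hf : ∀ x, 0 < f x) {B : ℝ}
    (hB : 0 ≤ B) (hfB : ∀ x z, N.rate x z ≠ 0 → f z ≤ B * f x) {E : Set (Fin d → ℕ)} {κ κ' : ℝ}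
    (hκ : κ' < κ) (hgen : ∀ x ∉ E, N.generator f x ≤ -κ * f x) :
    ∃ h₀ : ℝ, 0 < h₀ ∧ ∀ h, 0 ≤ h → h ≤ h₀ → ∀ x ∉ E,
      ∑' z, ENNReal.ofReal (f z) * ENNReal.ofReal (N.transitionProb h x z)
        ≤ ENNReal.ofReal (Real.exp (-κ' * h)) * ENNReal.ofReal (f x) := by
  obtain ⟨D, hD, hmain⟩ := N.exists_tsum_mul_transitionProb_le hf hB hfB
  set Λ := N.totalRate.toReal with hΛ
  have hΛ0 : 0 ≤ Λ := ENNReal.toReal_nonneg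
  -- The first two bounds make the expansion available; the third gives `D h ≤ κ - κ'`, hence `1 - κ
  -- h + D h² ≤ 1 - κ' h ≤ e^{-κ' h}`.
  refine ⟨min 1 (min (1 / (Λ + 1)) ((κ - κ') / (D + 1))), ?_, ?_⟩
  · have := sub_pos.2 hκ
    positivity
  · intro h hh hle x hx
    obtain ⟨h1, h2, h3⟩ : h ≤ 1 ∧ h ≤ 1 / (Λ + 1) ∧ h ≤ (κ - κ') / (D + 1) := by
      simpa [le_min_iff] using hle
    rw [le_div_iff₀ (by positivity)] at h2 h3
    refine (hmain h hh h1 (by linarith) x).trans ?_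
    rw [← ENNReal.ofReal_mul (Real.exp_pos _).le]
    refine ENNReal.ofReal_le_ofReal ?_
    have h4 : h * N.generator f x ≤ h * (-κ * f x) := mul_le_mul_of_nonneg_left (hgen x hx) hh
    have h5 : h * (D * h) ≤ h * (κ - κ') := mul_le_mul_of_nonneg_left (by linarith) hh
    have h6 := Real.add_one_le_exp (-κ' * h)
    calc f x + h * N.generator f x + D * h ^ 2 * f x
        ≤ (1 - κ * h + D * h ^ 2) * f x := by linarith
      _ ≤ Real.exp (-κ' * h) * f x := by
          refine mul_le_mul_of_nonneg_right ?_ (hf x).le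
          linarith

end JacksonNetwork

/-! ### From short times to the killed process and the essential spectral radius. -/

/-- If `F` is `ρ`-superharmonic for the kernel `K`, then so is it for the sums over paths. -/
lemma tsum_paths_le {S : Type*} (K : S → S → ℝ≥0∞) (F : S → ℝ≥0∞) (ρ : ℝ≥0∞)
    (hK : ∀ a, ∑' b, K a b * F b ≤ ρ * F a) (n : ℕ) (a : S) :
    ∑' w : Fin n → S, (∏ k : Fin n, K (Fin.cons (α := fun _ => S) a w k.castSucc) (w k))
      * F (Fin.cons (α := fun _ => S) a w (Fin.last n)) ≤ ρ ^ n * F a := by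
  induction n generalizing a with
  | zero =>
    rw [tsum_eq_single default fun w hw => absurd (Subsingleton.elim w default) hw]
    simp
  | succ n ih =>
    rw [← (Fin.consEquiv fun _ : Fin (n + 1) => S).tsum_eq, ENNReal.tsum_prod']
    calc ∑' (b : S) (w : Fin n → S),
          (∏ k : Fin (n + 1), K (Fin.cons (α := fun _ => S) a
            (Fin.consEquiv (fun _ : Fin (n + 1) => S) (b, w)) k.castSucc)
            (Fin.consEquiv (fun _ : Fin (n + 1) => S) (b, w) k))
          * F (Fin.cons (α := fun _ => S) a
            (Fin.consEquiv (fun _ : Fin (n + 1) => S) (b, w)) (Fin.last (n + 1)))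
        = ∑' b, K a b * ∑' w : Fin n → S,
          (∏ k : Fin n, K (Fin.cons (α := fun _ => S) b w k.castSucc) (w k))
            * F (Fin.cons (α := fun _ => S) b w (Fin.last n)) := by
          refine tsum_congr fun b => ?_
          rw [← ENNReal.tsum_mul_left]
          refine tsum_congr fun w => ?_
          rw [Fin.prod_univ_succ, ← mul_assoc]
          rfl
      _ ≤ ∑' b, K a b * (ρ ^ n * F b) :=
          ENNReal.tsum_le_tsum fun b => mul_le_mul_right (ih b) _
      _ = ρ ^ n * ∑' b, K a b * F b := by
          rw [← ENNReal.tsum_mul_left]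
          exact tsum_congr fun b => by ring
      _ ≤ ρ ^ n * (ρ * F a) := mul_le_mul_right (hK a) _
      _ = ρ ^ (n + 1) * F a := by ring

namespace JacksonNetwork

variable {d : ℕ} {N : JacksonNetwork d} {Ω : Type*} [MeasurableSpace Ω]
  {P : (Fin d → ℕ) → Measure Ω} {Z : ℝ≥0 → Ω → (Fin d → ℕ)}

lemma IsGeneratedMarkov.measure_ne_initial (hZ : N.IsGeneratedMarkov P Z) (x : Fin d → ℕ) :
    P x {ω | Z 0 ω ≠ x} = 0 := by
  have := hZ.isProbabilityMeasure x
  have h1 : P x {ω | Z 0 ω = x} = 1 := by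
    simpa using hZ.finiteDim x 0 (fun _ => 0) (fun _ => x) rfl monotone_const
  have hm : MeasurableSet {ω | Z 0 ω = x} := hZ.measurable 0 (measurableSet_singleton x)
  exact (prob_compl_eq_zero_iff hm).2 h1

/-- If `τ_E > n h`, the process avoids `E` at the grid times `h, …, n h`. The event is covered by
countably many grid paths outside `E`, whose probabilities are products of transition probabilities.
-/
lemma IsGeneratedMarkov.measure_killed_mul_le (hZ : N.IsGeneratedMarkov P Z)
    {E : Set (Fin d → ℕ)} {F : (Fin d → ℕ) → ℝ≥0∞} {ρ : ℝ≥0∞} {h : ℝ≥0} (hh : 0 < h)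
    (hK : ∀ x ∉ E, ∑' z, F z * ENNReal.ofReal (N.transitionProb h x z) ≤ ρ * F x)
    (n : ℕ) {x : Fin d → ℕ} (hx : x ∉ E) (y : Fin d → ℕ) :
    P x {ω | Z (n * h) ω = y ∧ ((n * h : ℝ≥0) : ℝ≥0∞) < hitTime Z E ω} * F y ≤ ρ ^ n * F x := by
  let S := {z : Fin d → ℕ // z ∉ E}
  let a : S := ⟨x, hx⟩
  let path : (Fin n → S) → Fin (n + 1) → S := fun w => Fin.cons (α := fun _ => S) a w
  -- `finiteDim` expects a sequence indexed by `ℕ`; the values beyond `n` are irrelevant.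
  let ext : (Fin n → S) → ℕ → Fin d → ℕ := fun w k =>
    if hk : k < n + 1 then (path w ⟨k, hk⟩ : Fin d → ℕ) else x
  let A : (Fin n → S) → Set Ω := fun w =>
    {ω | (path w (Fin.last n) : Fin d → ℕ) = y ∧ ∀ k ≤ n, Z (k * h) ω = ext w k}
  have hsub : {ω | Z (n * h) ω = y ∧ ((n * h : ℝ≥0) : ℝ≥0∞) < hitTime Z E ω} ⊆
      {ω | Z 0 ω ≠ x} ∪ ⋃ w, A w := by
    rintro ω ⟨hy, hτ⟩
    by_cases h0 : Z 0 ω = x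
    · right
      -- Time `0` is left out because `τ_E` only sees `t > 0`; there `Z = x ∉ E`.
      have hE : ∀ k : Fin n, Z (((k : ℕ) + 1 : ℕ) * h) ω ∉ E := by
        intro k hk
        refine absurd hτ (not_lt.2 ?_)
        refine (iInf₂_le (((k : ℕ) + 1 : ℕ) * h : ℝ≥0) ⟨by positivity, hk⟩).trans ?_
        refine ENNReal.coe_le_coe.2 (mul_le_mul_left ?_ h)
        exact Nat.cast_le.2 k.2
      have hval : ∀ k : Fin (n + 1),
          (path (fun k => ⟨_, hE k⟩) k : Fin d → ℕ) = Z ((k : ℕ) * h) ω := by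
        intro k
        refine Fin.cases ?_ (fun k => ?_) k
        · simp [path, a, h0]
        · simp [path]
      refine Set.mem_iUnion.2 ⟨fun k => ⟨_, hE k⟩, ?_, ?_⟩
      · rw [hval]
        exact hy
      · intro k hk
        simp only [ext]
        rw [dif_pos (Nat.lt_succ_of_le hk), hval]
    · exact Or.inl h0
  have hA : ∀ w, P x (A w) * F y ≤
      (∏ k : Fin n, ENNReal.ofReal (N.transitionProb h (path w k.castSucc) (w k)))
        * F (path w (Fin.last n)) := by
    intro w
    by_cases hw : (path w (Fin.last n) : Fin d → ℕ) = y
    · have hset : A w = {ω | ∀ k ≤ n, Z ((fun k : ℕ => (k * h : ℝ≥0)) k) ω = ext w k} := by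
        ext ω
        simp [A, hw]
      rw [hset, hZ.finiteDim x n (fun k : ℕ => (k * h : ℝ≥0)) (ext w) (by simp)
        (fun i j hij => mul_le_mul_left (Nat.cast_le.2 hij) h), hw]
      refine mul_le_mul_left ?_ _
      rw [if_pos (by simp [ext, path, a]), one_mul, Finset.prod_range]
      refine (Finset.prod_congr rfl fun k _ => ?_).le
      have e1 : ext w k = path w k.castSucc := dif_pos (by omega)
      have e2 : ext w (k + 1) = w k := by
        simp only [ext]
        rw [dif_pos (by omega)]
        rfl
      rw [e1, e2]
      congr 2
      push_cast
      ring
    · have : A w = ∅ := Set.eq_empty_of_forall_notMem fun ω hω => hw hω.1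
      simp [this]
  calc P x {ω | Z (n * h) ω = y ∧ ((n * h : ℝ≥0) : ℝ≥0∞) < hitTime Z E ω} * F y
      ≤ (∑' w, P x (A w)) * F y := by
        refine mul_le_mul_left ?_ _
        refine (measure_mono hsub).trans ((measure_union_le _ _).trans ?_)
        rw [hZ.measure_ne_initial, zero_add]
        exact measure_iUnion_le A
    _ ≤ ∑' w : Fin n → S, (∏ k : Fin n,
          ENNReal.ofReal (N.transitionProb h (path w k.castSucc) (w k)))
            * F (path w (Fin.last n)) := by
        rw [← ENNReal.tsum_mul_right]
        exact ENNReal.tsum_le_tsum hA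
    _ ≤ ρ ^ n * F x := by
        refine tsum_paths_le (S := S) (fun b c => ENNReal.ofReal (N.transitionProb h b c))
          (fun b => F b) ρ (fun b => ?_) n a
        refine le_trans ?_ (hK b b.2)
        simp only [mul_comm (ENNReal.ofReal _)]
        exact ENNReal.tsum_comp_le_tsum_of_injective Subtype.val_injective
          fun z => F z * ENNReal.ofReal (N.transitionProb h b z)

/-- A Lyapunov function for the process killed in `E` bounds its transition probabilities. -/
lemma IsGeneratedMarkov.measure_killed_le (hZ : N.IsGeneratedMarkov P Z)
    {f : (Fin d → ℕ) → ℝ} (hf : ∀ x, 0 < f x) {B : ℝ}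
    (hB : 0 ≤ B) (hfB : ∀ x z, N.rate x z ≠ 0 → f z ≤ B * f x) {E : Set (Fin d → ℕ)} {κ κ' : ℝ}
    (hκ : κ' < κ) (hgen : ∀ x ∉ E, N.generator f x ≤ -κ * f x)
    {x : Fin d → ℕ} (hx : x ∉ E) (y : Fin d → ℕ) {t : ℝ} (ht : 0 < t) :
    P x {ω | Z t.toNNReal ω = y ∧ ENNReal.ofReal t < hitTime Z E ω} ≤
      ENNReal.ofReal (f x / f y * Real.exp (-κ' * t)) := by
  obtain ⟨h₀, hh₀, hcon⟩ := N.exists_short_time_contraction hf hB hfB hκ hgen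
  obtain ⟨n, hn⟩ := exists_nat_gt (t / h₀)
  have hn0 : (0 : ℝ) < n := (div_pos ht hh₀).trans hn
  set h : ℝ≥0 := t.toNNReal / n with hh
  have hhr : (h : ℝ) = t / n := by simp [hh, ht.le]
  have hhpos : 0 < h := by
    rw [← NNReal.coe_pos, hhr]
    positivity
  have hnh : (n : ℝ≥0) * h = t.toNNReal := by
    rw [hh]
    exact mul_div_cancel₀ _ (by exact_mod_cast hn0.ne')
  have hle : (h : ℝ) ≤ h₀ := by
    rw [hhr, div_le_iff₀ hn0]
    rw [div_lt_iff₀ hh₀] at hn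
    linarith
  have key := hZ.measure_killed_mul_le hhpos
    (fun x hx => hcon h h.2 hle x hx) n hx y
  rw [hnh, ← ENNReal.ofReal_pow (Real.exp_pos _).le, ← Real.exp_nat_mul,
    ← ENNReal.ofReal_mul (Real.exp_pos _).le] at key
  have hexp : (n : ℝ) * (-κ' * h) = -κ' * t := by
    rw [hhr]
    field_simp
  rw [hexp] at key
  have hfy : ENNReal.ofReal (f y) ≠ 0 := by simpa using hf y
  rw [show f x / f y * Real.exp (-κ' * t) = Real.exp (-κ' * t) * f x / f y by ring,
    ENNReal.ofReal_div_of_pos (hf y), ENNReal.le_div_iff_mul_le (Or.inl hfy)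
      (Or.inl ENNReal.ofReal_ne_top)]
  exact key

/-- A Lyapunov function outside a finite set bounds the essential spectral radius. -/
lemma IsGeneratedMarkov.essSpectralRadius_le (hZ : N.IsGeneratedMarkov P Z)
    {f : (Fin d → ℕ) → ℝ} (hf : ∀ x, 0 < f x) {B : ℝ}
    (hB : 0 ≤ B) (hfB : ∀ x z, N.rate x z ≠ 0 → f z ≤ B * f x) {E : Set (Fin d → ℕ)}
    (hE : E.Finite) {κ κ' : ℝ} (hκ : κ' < κ) (hgen : ∀ x ∉ E, N.generator f x ≤ -κ * f x) :
    essSpectralRadius P Z ≤ ENNReal.ofReal (Real.exp (-κ')) := by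
  refine sInf_le ⟨Real.exp (-κ'), ⟨Real.exp_pos _, E, hE, fun x hx y _ => ?_⟩, rfl⟩
  -- Half of the gap is spent on the killed estimate at rate `κ' + δ < κ`; after the factor `r^{-t}
  -- = e^{κ' t}` an integrable `e^{-δ t}` remains.
  set δ := (κ - κ') / 2 with hδ
  have hδ0 : 0 < δ := by linarith
  calc ∫⁻ t in Set.Ioi (0 : ℝ), ENNReal.ofReal (Real.exp (-κ') ^ (-t)) *
        P x {ω | Z t.toNNReal ω = y ∧ ENNReal.ofReal t < hitTime Z E ω}
      ≤ ∫⁻ t in Set.Ioi (0 : ℝ), ENNReal.ofReal (f x / f y * Real.exp (-δ * t)) := by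
        refine setLIntegral_mono' measurableSet_Ioi fun t ht => ?_
        refine (mul_le_mul_right (hZ.measure_killed_le hf hB hfB
          (show κ' + δ < κ by linarith) hgen hx y ht) _).trans_eq ?_
        rw [← ENNReal.ofReal_mul (by positivity), ← Real.exp_mul, mul_left_comm, ← Real.exp_add]
        congr 3
        ring
    _ < ⊤ := by
        have hint : IntegrableOn (fun t : ℝ => f x / f y * Real.exp (-δ * t)) (Set.Ioi 0) :=
          (exp_neg_integrableOn_Ioi 0 hδ0).const_mul _
        exact hint.lintegral_lt_top

end JacksonNetwork

/-! ### The exponential Lyapunov function. -/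

namespace JacksonNetwork

variable {d : ℕ} (N : JacksonNetwork d)

lemma hasSum_single_jump (x : Fin d → ℕ) (v : Fin d → ℤ) (c : ℝ) (φ : (Fin d → ℤ) → ℝ)
    (hv : ∀ k, 0 ≤ (x k : ℤ) + v k) :
    HasSum (fun z : Fin d → ℕ => (if (fun k => (z k : ℤ) - (x k : ℤ)) = v then c else 0)
      * φ fun k => (z k : ℤ) - (x k : ℤ)) (c * φ v) := by
  have hz : (fun k => (((x k : ℤ) + v k).toNat : ℤ) - (x k : ℤ)) = v := by
    ext k
    rw [Int.toNat_of_nonneg (hv k)]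
    ring
  have h1 := hasSum_single
    (f := fun z : Fin d → ℕ => (if (fun k => (z k : ℤ) - (x k : ℤ)) = v then c else 0)
      * φ fun k => (z k : ℤ) - (x k : ℤ)) (fun k => ((x k : ℤ) + v k).toNat) ?_
  · simpa only [hz, if_true] using h1
  · intro z hzne
    rw [if_neg, zero_mul]
    intro h
    exact hzne (injective_displacement x (h.trans hz.symm))

lemma hasSum_single_jump_of_neg (x : Fin d → ℕ) (v : Fin d → ℤ) (c : ℝ) (φ : (Fin d → ℤ) → ℝ)
    (hv : ∃ k, (x k : ℤ) + v k < 0) :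
    HasSum (fun z : Fin d → ℕ => (if (fun k => (z k : ℤ) - (x k : ℤ)) = v then c else 0)
      * φ fun k => (z k : ℤ) - (x k : ℤ)) 0 := by
  convert hasSum_zero using 2 with z
  rw [if_neg, zero_mul]
  rintro rfl
  obtain ⟨k, hk⟩ := hv
  simp only at hk
  omega

/-- A jump leaving the orthant has no target state, so departures from queue `i` count only if `x_i
> 0`. -/
lemma tsum_rate_mul_displacement (x : Fin d → ℕ) (φ : (Fin d → ℤ) → ℝ) :
    ∑' z, N.rate x z * φ (fun k => (z k : ℤ) - (x k : ℤ)) =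
      (∑ i, N.arr i * φ (Pi.single i 1))
      + (∑ i, if 0 < x i then N.srv i * N.exitProb i * φ (-Pi.single i 1) else 0)
      + ∑ i, ∑ j, if 0 < x i then
          N.srv i * N.route i j * φ (Pi.single j 1 - Pi.single i 1) else 0 := by
  refine HasSum.tsum_eq ?_
  simp only [rate, jumpRate, add_mul, Finset.sum_mul]
  refine ((hasSum_sum fun i _ => ?_).add (hasSum_sum fun i _ => ?_)).add
    (hasSum_sum fun i _ => hasSum_sum fun j _ => ?_)
  · refine hasSum_single_jump x _ _ φ fun k => ?_
    rw [Pi.single_apply]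
    split_ifs <;> positivity
  · split_ifs with h
    · refine hasSum_single_jump x _ _ φ fun k => ?_
      rw [Pi.neg_apply, Pi.single_apply]
      split_ifs with hk
      · subst hk; omega
      · simp
    · exact hasSum_single_jump_of_neg x _ _ φ ⟨i, by simp; omega⟩
  · rcases eq_or_ne i j with rfl | hij
    · simp [N.route_self, hasSum_zero]
    · split_ifs with h
      · refine hasSum_single_jump x _ _ φ fun k => ?_
        rw [Pi.sub_apply, Pi.single_apply, Pi.single_apply]
        split_ifs with hk hk' hk'
        · omega
        · omega
        · subst hk'; omega
        · omega
      · exact hasSum_single_jump_of_neg x _ _ φ ⟨i, by simp [Pi.single_eq_of_ne hij]; omega⟩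

lemma generator_finset_sum {ι : Type*} (s : Finset ι) (f : ι → (Fin d → ℕ) → ℝ)
    (x : Fin d → ℕ) :
    N.generator (fun z => ∑ i ∈ s, f i z) x = ∑ i ∈ s, N.generator (f i) x := by
  simp only [generator_eq_sub, Finset.sum_sub_distrib, Finset.mul_sum]
  congr 1
  exact (hasSum_sum fun i _ => N.hasSum_rate_mul x (f i)).tsum_eq

/-- The exponential function `exp (γ⃗_i ⬝ x)`. -/
noncomputable def expFun (γ : Fin d → ℝ) (i : Fin d) (x : Fin d → ℕ) : ℝ :=
  Real.exp (N.gammaVec γ i ⬝ᵥ fun j => (x j : ℝ))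

lemma expFun_pos (γ : Fin d → ℝ) (i : Fin d) (x : Fin d → ℕ) : 0 < N.expFun γ i x :=
  Real.exp_pos _

lemma one_le_weight {γ : Fin d → ℝ} (hγ : ∀ i, 0 ≤ γ i) (i j : Fin d) :
    1 ≤ 1 + N.hitProb j i * γ i :=
  le_add_of_nonneg_right (mul_nonneg (N.hitProb_nonneg j i) (hγ i))

lemma gammaVec_nonneg {γ : Fin d → ℝ} (hγ : ∀ i, 0 ≤ γ i) (i j : Fin d) :
    0 ≤ N.gammaVec γ i j :=
  Real.log_nonneg (N.one_le_weight hγ i j)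

lemma exp_gammaVec {γ : Fin d → ℝ} (hγ : ∀ i, 0 ≤ γ i) (i j : Fin d) :
    Real.exp (N.gammaVec γ i j) = 1 + N.hitProb j i * γ i :=
  Real.exp_log (zero_lt_one.trans_le (N.one_le_weight hγ i j))

lemma expFun_le_of_rate_ne_zero {γ : Fin d → ℝ} (hγ : ∀ i, 0 ≤ γ i) (i : Fin d)
    {x z : Fin d → ℕ} (h : N.rate x z ≠ 0) :
    N.expFun γ i z ≤ Real.exp (∑ j, N.gammaVec γ i j) * N.expFun γ i x := by
  unfold expFun
  rw [← Real.exp_add]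
  refine Real.exp_le_exp.2 ?_
  simp only [dotProduct]
  rw [← Finset.sum_add_distrib]
  refine Finset.sum_le_sum fun j _ => ?_
  have h1 := (abs_le.1 (N.abs_displacement_le_one h j)).2
  have h2 : (z j : ℝ) ≤ 1 + x j := by
    have : z j ≤ 1 + x j := by omega
    exact_mod_cast this
  calc N.gammaVec γ i j * z j ≤ N.gammaVec γ i j * (1 + x j) :=
        mul_le_mul_of_nonneg_left h2 (N.gammaVec_nonneg hγ i j)
    _ = _ := by ring

/-- The drift out of queue `i` of the weight `1 + Q_{·i₀} γ_{i₀}`. -/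
lemma service_drift {N : JacksonNetwork d} (hA : N.AssumptionA) {γ : Fin d → ℝ}
    (hγ : ∀ i, 0 ≤ γ i) (i₀ i : Fin d) :
    N.exitProb i * ((1 + N.hitProb i i₀ * γ i₀)⁻¹ - 1)
      + ∑ j, N.route i j * ((1 + N.hitProb j i₀ * γ i₀) * (1 + N.hitProb i i₀ * γ i₀)⁻¹ - 1)
      = if i = i₀ then -(γ i₀ / N.green i₀ i₀ / (1 + γ i₀)) else 0 := by
  have ha : (1 + N.hitProb i i₀ * γ i₀) ≠ 0 :=
    (zero_lt_one.trans_le (N.one_le_weight hγ i₀ i)).ne'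
  have h1 : ∑ j, N.route i j * ((1 + N.hitProb j i₀ * γ i₀) * (1 + N.hitProb i i₀ * γ i₀)⁻¹ - 1)
      = (∑ j, N.route i j) * ((1 + N.hitProb i i₀ * γ i₀)⁻¹ - 1)
        + (∑ j, N.route i j * N.hitProb j i₀) * (γ i₀ * (1 + N.hitProb i i₀ * γ i₀)⁻¹) := by
    rw [Finset.sum_mul, Finset.sum_mul, ← Finset.sum_add_distrib]
    exact Finset.sum_congr rfl fun j _ => by ring
  rw [h1, exitProb]
  -- Leaving the network gives weight `1`, as if `Q_{0 i₀} = 0`. Off `i₀` the weight is therefore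
  -- harmonic; at `i₀` the defect is the no-return probability `1 / G_{i₀ i₀}`.
  split_ifs with h
  · subst h
    have h2 := green_self hA i
    have hγ1 : 1 + γ i ≠ 0 := by linarith [hγ i]
    rw [show ∑ k, N.route i k * N.hitProb k i = 1 - (N.green i i)⁻¹ by linarith, hitProb_self,
      one_mul, div_eq_mul_inv (γ i)]
    field_simp
    ring
  · have h2 := N.hitProb_eq i i₀
    rw [if_neg h] at h2
    rw [← h2]
    field_simp
    ring

/-- Each jump changes the exponential by a factor independent of `x`. Arrivals add up to `γ_i ν_i /
G_ii` by the traffic equations, and by `service_drift` only services at queue `i` contribute. -/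
lemma generator_expFun {N : JacksonNetwork d} (hA : N.AssumptionA) {ν : Fin d → ℝ}
    (hν : N.IsTrafficSolution ν) {γ : Fin d → ℝ} (hγ : ∀ i, 0 ≤ γ i) (i : Fin d)
    (x : Fin d → ℕ) :
    N.generator (N.expFun γ i) x =
      γ i / N.green i i * (ν i - if 0 < x i then N.srv i / (1 + γ i) else 0)
        * N.expFun γ i x := by
  set φ : (Fin d → ℤ) → ℝ := fun v => Real.exp (∑ j, N.gammaVec γ i j * (v j : ℝ)) - 1 with hφ
  have hdiff : ∀ z, N.rate x z * (N.expFun γ i z - N.expFun γ i x)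
      = N.expFun γ i x * (N.rate x z * φ fun k => (z k : ℤ) - (x k : ℤ)) := by
    intro z
    have : N.expFun γ i z = N.expFun γ i x *
        Real.exp (∑ j, N.gammaVec γ i j * (((z j : ℤ) - (x j : ℤ) : ℤ) : ℝ)) := by
      unfold expFun
      rw [← Real.exp_add]
      congr 1
      simp only [dotProduct, ← Finset.sum_add_distrib]
      refine Finset.sum_congr rfl fun j _ => ?_
      push_cast
      ring
    rw [this, hφ]
    ring
  have hs : ∀ j : Fin d, ∑ k, N.gammaVec γ i k * ((Pi.single j 1 : Fin d → ℤ) k : ℝ)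
      = N.gammaVec γ i j := by
    intro j
    rw [Finset.sum_eq_single j]
    · simp
    · intro k _ hk
      simp [Pi.single_eq_of_ne hk]
    · simp
  have e1 : ∀ j, φ (Pi.single j 1) = N.hitProb j i * γ i := by
    intro j
    rw [hφ]
    simp only [hs, N.exp_gammaVec hγ]
    ring
  have e2 : ∀ j, φ (-Pi.single j 1) = (1 + N.hitProb j i * γ i)⁻¹ - 1 := by
    intro j
    rw [hφ]
    simp only [Pi.neg_apply, Int.cast_neg, mul_neg, Finset.sum_neg_distrib, hs, Real.exp_neg,
      N.exp_gammaVec hγ]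
  have e3 : ∀ j k, φ (Pi.single k 1 - Pi.single j 1)
      = (1 + N.hitProb k i * γ i) * (1 + N.hitProb j i * γ i)⁻¹ - 1 := by
    intro j k
    rw [hφ]
    simp only [Pi.sub_apply, Int.cast_sub, mul_sub, Finset.sum_sub_distrib, hs, Real.exp_sub,
      N.exp_gammaVec hγ, div_eq_mul_inv]
  rw [generator_eq_tsum]
  simp only [hdiff]
  rw [tsum_mul_left, tsum_rate_mul_displacement]
  simp only [e1, e2, e3]
  have harr : ∑ j, N.arr j * (N.hitProb j i * γ i) = γ i / N.green i i * ν i := by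
    simp only [← mul_assoc]
    rw [← Finset.sum_mul, sum_arr_mul_hitProb hA hν]
    ring
  have hsrv : (∑ j, if 0 < x j then
        N.srv j * N.exitProb j * ((1 + N.hitProb j i * γ i)⁻¹ - 1) else 0)
      + ∑ j, ∑ k, (if 0 < x j then N.srv j * N.route j k *
          ((1 + N.hitProb k i * γ i) * (1 + N.hitProb j i * γ i)⁻¹ - 1) else 0)
      = -(γ i / N.green i i * if 0 < x i then N.srv i / (1 + γ i) else 0) := by
    rw [← Finset.sum_add_distrib, Finset.sum_eq_single i]
    · split_ifs with h
      · have := service_drift hA hγ i i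
        rw [if_pos rfl] at this
        simp only [mul_assoc (N.srv i)]
        rw [← Finset.mul_sum, ← mul_add, this]
        ring
      · simp
    · intro j _ hj
      split_ifs with h
      · have := service_drift hA hγ i j
        rw [if_neg hj] at this
        simp only [mul_assoc (N.srv j)]
        rw [← Finset.mul_sum, ← mul_add, this, mul_zero]
      · simp
    · simp
  rw [add_assoc, harr, hsrv]
  ring

/-- On the face `v^i = 0` the linear form `γ⃗_i` is dominated with a uniform gap. -/
lemma exists_gap {N : JacksonNetwork d} {γ : Fin d → ℝ} (hγ : γ ∈ N.gammaSet) (i : Fin d) :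
    ∃ δ : ℝ, 0 < δ ∧ ∀ v : Fin d → ℝ, (∀ j, 0 ≤ v j) → v i = 0 →
      ∃ j, N.gammaVec γ i ⬝ᵥ v + δ * ∑ k, v k ≤ N.gammaVec γ j ⬝ᵥ v := by
  have : Nonempty (Fin d) := ⟨i⟩
  -- Both sides are homogeneous in `v`, so the gap is the minimum of a continuous positive function
  -- on a compact face of the simplex.
  set K : Set (Fin d → ℝ) := {v | (∀ j, 0 ≤ v j) ∧ v i = 0 ∧ ∑ k, v k = 1} with hK
  have hKc : IsCompact K := by
    refine (isCompact_Icc (a := (0 : Fin d → ℝ)) (b := 1)).of_isClosed_subset ?_ ?_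
    · simp only [hK, Set.ofPred_and, Set.ofPred_forall]
      refine (isClosed_iInter fun j => isClosed_le continuous_const (continuous_apply j)).inter
        ((isClosed_eq (continuous_apply i) continuous_const).inter
          (isClosed_eq (by fun_prop) continuous_const))
    · rintro v ⟨h0, -, h1⟩
      refine ⟨h0, fun j => ?_⟩
      rw [Pi.one_apply, ← h1]
      exact Finset.single_le_sum (fun k _ => h0 k) (Finset.mem_univ j)
  have hcont : Continuous fun v : Fin d → ℝ =>
      (⨆ j, N.gammaVec γ j ⬝ᵥ v) - N.gammaVec γ i ⬝ᵥ v := by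
    simp only [← Finset.sup'_univ_eq_ciSup]
    have hdot : ∀ j, Continuous fun v : Fin d → ℝ => N.gammaVec γ j ⬝ᵥ v := by
      intro j
      unfold dotProduct
      fun_prop
    exact (Continuous.finset_sup'_apply _ fun j _ => hdot j).sub (hdot i)
  have hscale : ∀ δ : ℝ, (∀ v ∈ K, δ ≤ (⨆ j, N.gammaVec γ j ⬝ᵥ v) - N.gammaVec γ i ⬝ᵥ v) →
      ∀ v : Fin d → ℝ, (∀ j, 0 ≤ v j) → v i = 0 →
      ∃ j, N.gammaVec γ i ⬝ᵥ v + δ * ∑ k, v k ≤ N.gammaVec γ j ⬝ᵥ v := by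
    intro δ hδ v hv hvi
    rcases (Finset.sum_nonneg fun k (_ : k ∈ Finset.univ) => hv k).eq_or_lt with hs | hs
    · exact ⟨i, by rw [← hs]; simp⟩
    · set s := ∑ k, v k with hsdef
      have hmem : s⁻¹ • v ∈ K := by
        refine ⟨fun j => mul_nonneg (inv_nonneg.2 hs.le) (hv j), by simp [hvi], ?_⟩
        simp only [Pi.smul_apply, smul_eq_mul]
        rw [← Finset.mul_sum, ← hsdef, inv_mul_cancel₀ hs.ne']
      obtain ⟨j, hj⟩ := exists_eq_ciSup_of_finite (f := fun j => N.gammaVec γ j ⬝ᵥ (s⁻¹ • v))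
      have h1 := hδ _ hmem
      rw [← hj] at h1
      simp only [dotProduct_smul, smul_eq_mul] at h1
      refine ⟨j, ?_⟩
      rw [← mul_sub, inv_mul_eq_div, le_div_iff₀ hs] at h1
      linarith
  -- The face is empty when `d = 1`.
  rcases K.eq_empty_or_nonempty with hne | hne
  · exact ⟨1, one_pos, hscale 1 (by simp [hne])⟩
  · obtain ⟨v₀, hv₀, hmin⟩ := hKc.exists_isMinOn hne hcont.continuousOn
    refine ⟨_, ?_, hscale _ fun v hv => hmin hv⟩
    refine sub_pos.2 (hγ.2 i v₀ hv₀.1 ?_ hv₀.2.1)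
    rintro rfl
    simpa using hv₀.2.2

/-- The Lyapunov function `∑_i exp (γ⃗_i ⬝ x)` decays at rate almost
`min_i γ_i / G_ii (μ_i / (1 + γ_i) - ν_i)` outside a finite set. -/
lemma exists_finite_generator_le {N : JacksonNetwork d} (hA : N.AssumptionA) {ν : Fin d → ℝ}
    (hν : N.IsTrafficSolution ν) {γ : Fin d → ℝ} (hγ : γ ∈ N.gammaSet) {ε : ℝ} (hε : 0 < ε) :
    ∃ E : Set (Fin d → ℕ), E.Finite ∧ ∀ x ∉ E,
      N.generator (fun z => ∑ i, N.expFun γ i z) x ≤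
        -((⨅ i, γ i / N.green i i * (N.srv i / (1 + γ i) - ν i)) - ε)
          * ∑ i, N.expFun γ i x := by
  choose δ hδ hgap using exists_gap hγ
  set θ := ⨅ i, γ i / N.green i i * (N.srv i / (1 + γ i) - ν i) with hθ
  -- `b i` bounds the service term lost when `x_i = 0`.
  set b : Fin d → ℝ := fun i => |γ i / N.green i i * (N.srv i / (1 + γ i))| with hb
  have hlim : Filter.Tendsto (fun s : ℝ => ∑ i, b i * Real.exp (-(δ i * s))) Filter.atTop
      (nhds 0) := by
    rw [← Finset.sum_const_zero (s := (Finset.univ : Finset (Fin d)))]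
    refine tendsto_finsetSum _ fun i _ => ?_
    rw [← mul_zero (b i)]
    exact (Real.tendsto_exp_neg_atTop_nhds_zero.comp
      (Filter.tendsto_id.const_mul_atTop (hδ i))).const_mul _
  obtain ⟨M, hM⟩ := Filter.eventually_atTop.1 (hlim.eventually_le_const hε)
  refine ⟨{x | ∑ k, (x k : ℝ) < M}, ?_, fun x hx => ?_⟩
  · refine (Set.finite_Iic (fun _ : Fin d => ⌈M⌉₊)).subset fun x hx k => ?_
    have h1 : (x k : ℝ) ≤ ∑ k, (x k : ℝ) :=
      Finset.single_le_sum (f := fun k => (x k : ℝ)) (fun _ _ => Nat.cast_nonneg _)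
        (Finset.mem_univ k)
    have h2 : (x k : ℝ) ≤ ⌈M⌉₊ := h1.trans ((le_of_lt hx).trans (Nat.le_ceil M))
    exact_mod_cast h2
  · set s := ∑ k, (x k : ℝ) with hs
    have hMs := hM s (not_lt.1 hx)
    set f := ∑ i, N.expFun γ i x with hf
    have hf0 : 0 ≤ f := Finset.sum_nonneg fun i _ => (N.expFun_pos γ i x).le
    rw [generator_finset_sum]
    have hterm : ∀ i, N.generator (N.expFun γ i) x
        ≤ -θ * N.expFun γ i x + b i * Real.exp (-(δ i * s)) * f := by
      intro i
      have hθi : θ ≤ γ i / N.green i i * (N.srv i / (1 + γ i) - ν i) :=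
        ciInf_le (Set.finite_range _).bddBelow i
      have hpos := N.expFun_pos γ i x
      rw [generator_expFun hA hν hγ.1]
      split_ifs with h
      · have h1 := mul_le_mul_of_nonneg_right hθi hpos.le
        have h2 : 0 ≤ b i * Real.exp (-(δ i * s)) * f :=
          mul_nonneg (mul_nonneg (abs_nonneg _) (Real.exp_pos _).le) hf0
        linarith
      · obtain ⟨j, hj⟩ := hgap i (fun k => (x k : ℝ)) (fun k => Nat.cast_nonneg _)
          (by simpa using h)
        have hdom : N.expFun γ i x ≤ Real.exp (-(δ i * s)) * f := by
          calc N.expFun γ i x ≤ Real.exp (-(δ i * s)) * N.expFun γ j x := by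
                unfold expFun
                rw [← Real.exp_add]
                exact Real.exp_le_exp.2 (by linarith)
            _ ≤ Real.exp (-(δ i * s)) * f := by
                refine mul_le_mul_of_nonneg_left ?_ (Real.exp_pos _).le
                exact Finset.single_le_sum (fun k _ => (N.expFun_pos γ k x).le)
                  (Finset.mem_univ j)
        have hbi := le_abs_self (γ i / N.green i i * (N.srv i / (1 + γ i)))
        have h1 : γ i / N.green i i * (ν i - 0) ≤ -θ + b i := by
          rw [mul_sub] at hθi
          linarith
        calc γ i / N.green i i * (ν i - 0) * N.expFun γ i x
            ≤ (-θ + b i) * N.expFun γ i x := mul_le_mul_of_nonneg_right h1 hpos.le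
          _ = -θ * N.expFun γ i x + b i * N.expFun γ i x := by ring
          _ ≤ -θ * N.expFun γ i x + b i * (Real.exp (-(δ i * s)) * f) := by
              gcongr
          _ = _ := by ring
    calc ∑ i, N.generator (N.expFun γ i) x
        ≤ ∑ i, (-θ * N.expFun γ i x + b i * Real.exp (-(δ i * s)) * f) :=
          Finset.sum_le_sum fun i _ => hterm i
      _ = -θ * f + (∑ i, b i * Real.exp (-(δ i * s))) * f := by
          rw [Finset.sum_add_distrib, ← Finset.mul_sum, ← Finset.sum_mul]
      _ ≤ -θ * f + ε * f := by gcongr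
      _ = _ := by ring

lemma IsGeneratedMarkov.log_essSpectralRadius_le [Nonempty (Fin d)] {N : JacksonNetwork d}
    {Ω : Type*} [MeasurableSpace Ω] {P : (Fin d → ℕ) → Measure Ω} {Z : ℝ≥0 → Ω → (Fin d → ℕ)}
    (hZ : N.IsGeneratedMarkov P Z) (hA : N.AssumptionA) {ν : Fin d → ℝ}
    (hν : N.IsTrafficSolution ν) {γ : Fin d → ℝ} (hγ : γ ∈ N.gammaSet) {a : ℝ}
    (ha : a < ⨅ i, γ i / N.green i i * (N.srv i / (1 + γ i) - ν i)) :
    ENNReal.log (essSpectralRadius P Z) ≤ ((-a : ℝ) : EReal) := by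
  set θ := ⨅ i, γ i / N.green i i * (N.srv i / (1 + γ i) - ν i) with hθ
  -- With `ε = (θ - a) / 2` the decay rate `θ - ε` still exceeds `a`.
  obtain ⟨E, hE, hgen⟩ := exists_finite_generator_le hA hν hγ (show 0 < (θ - a) / 2 by linarith)
  have hr := hZ.essSpectralRadius_le (f := fun z => ∑ i, N.expFun γ i z)
    (B := ∑ i, Real.exp (∑ j, N.gammaVec γ i j)) (κ' := a)
    (fun x => Finset.sum_pos (fun i _ => N.expFun_pos γ i x) Finset.univ_nonempty)
    (Finset.sum_nonneg fun i _ => (Real.exp_pos _).le) ?_ hE (by linarith) hgen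
  · refine (ENNReal.log_le_log hr).trans_eq ?_
    rw [ENNReal.log_ofReal_of_pos (Real.exp_pos _), Real.log_exp]
  · intro x z h
    rw [Finset.mul_sum]
    refine Finset.sum_le_sum fun i _ => (N.expFun_le_of_rate_ne_zero hγ.1 i h).trans ?_
    refine mul_le_mul_of_nonneg_right ?_ (N.expFun_pos γ i x).le
    exact Finset.single_le_sum (f := fun i => Real.exp (∑ j, N.gammaVec γ i j))
      (fun k _ => (Real.exp_pos _).le) (Finset.mem_univ i)

end JacksonNetwork

theorem mainTheorem6 {d : ℕ} (hd : 0 < d) (N : JacksonNetwork d) (hA : N.AssumptionA)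
    (ν : Fin d → ℝ) (hν : N.IsTrafficSolution ν) (hB : ∀ i, ν i < N.srv i)
    {Ω : Type*} [MeasurableSpace Ω]
    (P : (Fin d → ℕ) → Measure Ω) (Z : ℝ≥0 → Ω → (Fin d → ℕ)) (hZ : N.IsGeneratedMarkov P Z) :
    ENNReal.log (essSpectralRadius P Z) ≤
      -⨆ γ ∈ N.gammaSet,
        ((⨅ i, γ i / N.green i i * (N.srv i / (1 + γ i) - ν i) : ℝ) : EReal) := by
  have : Nonempty (Fin d) := ⟨⟨0, hd⟩⟩
  -- Since the Lyapunov argument loses an arbitrarily small amount, each minimum is approached by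
  -- reals `a` strictly below it.
  refine EReal.le_neg_of_le_neg (iSup₂_le fun γ hγ => EReal.ge_of_forall_gt_iff_ge.1 fun a ha => ?_)
  refine EReal.le_neg_of_le_neg ?_
  simpa using hZ.log_essSpectralRadius_le hA hν hγ (EReal.coe_lt_coe_iff.1 ha)
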